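/- Let $(\mathsf Y,\mathcal Y)$ be a measurable space and $P$ a Markov transition kernel on it. For a probability measure $\mu$ on $\mathsf Y$, let $\mathbb P_\mu$ (with expectation $\mathbb E_\mu$) be the law of the Markov chain $(Y_n)_{n\ge 0}$ with initial distribution $\mu$ and transition kernel $P$, and let $\mu P^k$ be the law of $Y_k$ under $\mathbb P_\mu$. Assume that $P$ is positive Harris recurrent (there is a nonzero $\sigma$-finite measure $\varphi$ such that, from every starting point, the chain almost surely visits every set $A$ with $\varphi(A)>0$ infinitely often, and $P$ has an invariant probability measure) with a unique stationary distribution $\pi$. Assume moreover that there are a measurable $V:\mathsf Y\to[1,\infty)$ with $\pi(V)<\infty$ and a nonnegative non-increasing sequence $(\rho(k))_{k\ge0}$ with $\rho(k)\to 0$ such that, for all probability measures $\mu,\mu'$ on $\mathsf Y$ and all integers $k\ge 0$, $$\|\mu P^k-\mu'P^k\|_{\mathrm{TV}}\le \rho(k)\,[\mu(V)+\mu'(V)],$$ where $\|\nu-\nu'\|_{\mathrm{TV}}=\sup\{|\nu(f)-\nu'(f)| : f \text{ measurable},\ |f|\le 1\}$. Assume finally that $\rho(n)=O(n^{-r})$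 for some $r>1$. Let $m\ge1$ and let $h:\mathsf Y^m\to\mathbb R$ be measurable and symmetric (invariant under permutations of its arguments) such that, for some $\delta>0$, $$\sup_{(y_1,\dots,y_m)\in\mathsf Y^m}\frac{|h(y_1,\dots,y_m)|\,(\log^+|h(y_1,\dots,y_m)|)^{1+\delta}}{\sum_{i=1}^m V(y_i)}<\infty .$$ Then, for every probability measure $\mu$ on $\mathsf Y$ with $M(\mu,V):=\sup_{k\ge0}\mu P^k(V)<\infty$, the variables $h(Y_{i_1},\dots,Y_{i_m})$, $1\le i_1<\dots<i_m$, are $\mathbb P_\mu$-integrable, $h$ is $\pi^{\otimes m}$-integrable, and, as $n\to\infty$, $$\binom nm^{-1}\sum_{1\le i_1<\dots<i_m\le n}\bigl\{h(Y_{i_1},\dots,Y_{i_m})-\mathbb E_\mu[h(Y_{i_1},\dots,Y_{i_m})]\bigr\}\longrightarrow 0\qquad \mathbb P_\mu\text{-a.s.}$$ and $$\binom nm^{-1}\sum_{1\le i_1<\dots<i_m\le n}\mathbb E_\mu[h(Y_{i_1},\dots,Y_{i_m})]\longrightarrow\int \pi(\mathrm dy_1)\cdots\pi(\mathrm dy_m)\,h(y_1,\dots,y_m).$$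 -/

import Mathlib

open MeasureTheory ProbabilityTheory Filter Topology
open scoped ENNReal

namespace UStatMarkov

noncomputable section

/-- The law `ℙ_μ` on `ℕ → Y` of the (canonical) Markov chain `(Y_n)_{n ≥ 0}` with initial
distribution `μ` and transition kernel `P`; `Y_n` is the `n`-th coordinate map. -/
def chainLaw {Y : Type*} [MeasurableSpace Y] (P : Kernel Y Y) [IsMarkovKernel P]
    (μ : Measure Y) : Measure (ℕ → Y) :=
  Kernel.trajMeasure (X := fun _ => Y) μ
    (fun n => P.comap (fun x : (i : Finset.Iic n) → Y => x ⟨n, Finset.mem_Iic.2 le_rfl⟩)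
      (measurable_pi_apply _))

/-- `μ P^k`, the law at time `k` of the chain started from `μ`. -/
def lawAt {Y : Type*} [MeasurableSpace Y] (P : Kernel Y Y) (μ : Measure Y) (k : ℕ) : Measure Y :=
  μ.bind (P ^ k : Kernel Y Y)

/-- The total variation norm `‖μ - ν‖ = sup {|μ(f) - ν(f)| : f measurable, |f| ≤ 1}` of the
difference of two finite measures. -/
def tvNorm {Y : Type*} [MeasurableSpace Y] (μ ν : Measure Y) : ℝ≥0∞ :=
  ⨆ (f : Y → ℝ) (_ : Measurable f) (_ : ∀ y, |f y| ≤ 1),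
    ENNReal.ofReal |∫ y, f y ∂μ - ∫ y, f y ∂ν|

/-- `μ(V) ∈ [0, ∞]` for a nonnegative function `V`. -/
def vMoment {Y : Type*} [MeasurableSpace Y] (μ : Measure Y) (V : Y → ℝ) : ℝ≥0∞ :=
  ∫⁻ y, ENNReal.ofReal (V y) ∂μ

/-- `M(μ, V) = sup_{k ≥ 0} μ P^k (V) ∈ [0, ∞]`. -/
def supMoment {Y : Type*} [MeasurableSpace Y] (P : Kernel Y Y) (μ : Measure Y) (V : Y → ℝ) :
    ℝ≥0∞ :=
  ⨆ k : ℕ, vMoment (lawAt P μ k) V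

/-- Harris recurrence: there is a nontrivial σ-finite measure `φ` such that, from every starting
point, the chain almost surely visits every set of positive `φ`-measure infinitely often. -/
def IsHarrisRecurrent {Y : Type*} [MeasurableSpace Y] (P : Kernel Y Y) [IsMarkovKernel P] :
    Prop :=
  ∃ φ : Measure Y, SigmaFinite φ ∧ φ ≠ 0 ∧
    ∀ A : Set Y, MeasurableSet A → 0 < φ A →
      ∀ x : Y, ∀ᵐ ω ∂(chainLaw P (Measure.dirac x)), ∃ᶠ n in atTop, ω n ∈ A

/-- Positive Harris recurrence: Harris recurrence and existence of an invariant probability. -/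
def IsPositiveHarrisRecurrent {Y : Type*} [MeasurableSpace Y] (P : Kernel Y Y)
    [IsMarkovKernel P] : Prop :=
  IsHarrisRecurrent P ∧ ∃ π : Measure Y, IsProbabilityMeasure π ∧ Kernel.Invariant P π

/-- The ergodicity assumption on the kernel `P`, with stationary distribution `π`,
function `V` and rate `ρ`. -/
structure ErgodicityAssumption {Y : Type*} [MeasurableSpace Y] (P : Kernel Y Y)
    [IsMarkovKernel P] (π : Measure Y) (V : Y → ℝ) (ρ : ℕ → ℝ) : Prop where
  positiveHarris : IsPositiveHarrisRecurrent P
  isProbabilityMeasure : IsProbabilityMeasure π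
  invariant : Kernel.Invariant P π
  unique : ∀ π' : Measure Y, IsProbabilityMeasure π' → Kernel.Invariant P π' → π' = π
  measurable_V : Measurable V
  one_le_V : ∀ y, 1 ≤ V y
  rho_nonneg : ∀ k, 0 ≤ ρ k
  rho_antitone : Antitone ρ
  rho_tendsto : Tendsto ρ atTop (𝓝 0)
  contraction : ∀ μ μ' : Measure Y, IsProbabilityMeasure μ → IsProbabilityMeasure μ' →
    ∀ k : ℕ, tvNorm (lawAt P μ k) (lawAt P μ' k) ≤
      ENNReal.ofReal (ρ k) * (vMoment μ V + vMoment μ' V)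
  moment_pi : vMoment π V < ∞

/-- `h : Y^m → ℝ` is invariant under permutations of its arguments. -/
def IsSymmetric {Y : Type*} {m : ℕ} (h : (Fin m → Y) → ℝ) : Prop :=
  ∀ (σ : Equiv.Perm (Fin m)) (y : Fin m → Y), h (fun j => y (σ j)) = h y

/-- The index tuples `1 ≤ i_1 < ⋯ < i_m ≤ n`. -/
def tuples (m n : ℕ) : Finset (Fin m → ℕ) :=
  (Fintype.piFinset fun _ : Fin m => Finset.Icc 1 n).filter fun i => ∀ a b, a < b → i a < i b

end

end UStatMarkov

open UStatMarkov

namespace UStatMarkov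

section Chain

variable {Y : Type*} [MeasurableSpace Y]

instance isMarkovKernel_pow (P : Kernel Y Y) [IsMarkovKernel P] (k : ℕ) :
    IsMarkovKernel (P ^ k) := by
  induction k with
  | zero => rw [pow_zero]; exact inferInstanceAs (IsMarkovKernel Kernel.id)
  | succ k ih => rw [pow_succ]; exact inferInstanceAs (IsMarkovKernel ((P ^ k) ∘ₖ P))

lemma lawAt_dirac (P : Kernel Y Y) (x : Y) (k : ℕ) : lawAt P (Measure.dirac x) k = (P ^ k) x := by
  rw [lawAt, Measure.dirac_bind (Kernel.measurable _)]

lemma lawAt_zero (P : Kernel Y Y) (μ : Measure Y) : lawAt P μ 0 = μ := by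
  rw [lawAt, pow_zero]
  exact Measure.id_comp

lemma lawAt_of_invariant (P : Kernel Y Y) {π : Measure Y} (hπ : Kernel.Invariant P π) (k : ℕ) :
    lawAt P π k = π := by
  induction k with
  | zero => exact lawAt_zero P π
  | succ k ih =>
    have h : Kernel.Invariant (P ∘ₖ (P ^ k)) π := Kernel.Invariant.comp hπ ih
    rw [lawAt, pow_succ']
    exact h

variable (P : Kernel Y Y) [IsMarkovKernel P] (μ : Measure Y)

instance isProbabilityMeasure_chainLaw [IsProbabilityMeasure μ] :
    IsProbabilityMeasure (chainLaw P μ) := by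
  unfold chainLaw; infer_instance

lemma chainLaw_map_zero [IsProbabilityMeasure μ] :
    (chainLaw P μ).map (fun ω => ω 0) = μ := by
  have hev : (fun ω : ℕ → Y => ω 0) =
      (fun u : (i : Finset.Iic 0) → Y => u ⟨0, Finset.mem_Iic.2 le_rfl⟩) ∘
        (Preorder.frestrictLe (π := fun _ => Y) 0) := rfl
  rw [hev, ← Measure.map_map (measurable_pi_apply _) (by fun_prop), chainLaw,
    Kernel.trajMeasure, Measure.map_comp _ _ (by fun_prop), Kernel.traj_map_frestrictLe,
    Kernel.partialTraj_self, Measure.id_comp, Measure.map_map (measurable_pi_apply _) (by fun_prop)]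
  convert Measure.map_id using 2
  rfl

lemma lintegral_chainLaw_succ [IsProbabilityMeasure μ] (n : ℕ)
    {f : ((i : Finset.Iic n) → Y) × Y → ℝ≥0∞} (hf : Measurable f) :
    ∫⁻ ω, f (Preorder.frestrictLe (π := fun _ => Y) n ω, ω (n + 1)) ∂(chainLaw P μ) =
      ∫⁻ ω, ∫⁻ y, f (Preorder.frestrictLe (π := fun _ => Y) n ω, y) ∂(P (ω n))
        ∂(chainLaw P μ) := by
  have h := Kernel.map_frestrictLe_trajMeasure_compProd_eq_map_trajMeasure (X := fun _ => Y)
    (μ₀ := μ) (κ := fun n => P.comap (fun x : (i : Finset.Iic n) → Y =>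
      x ⟨n, Finset.mem_Iic.2 le_rfl⟩) (measurable_pi_apply _)) (a := n)
  have h' := congrArg (fun ν => ∫⁻ x, f x ∂ν) h
  rw [Measure.lintegral_compProd hf, lintegral_map hf (by fun_prop),
    lintegral_map (Measurable.lintegral_kernel_prod_right' hf) (by fun_prop)] at h'
  exact h'.symm

/-- The Markov property: given the path up to time `s`, the state at time `s + k` has law
`P ^ k (Y_s, ·)`. -/
lemma lintegral_chainLaw_add [IsProbabilityMeasure μ] (s k : ℕ)
    {f : ((i : Finset.Iic s) → Y) × Y → ℝ≥0∞} (hf : Measurable f) :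
    ∫⁻ ω, f (Preorder.frestrictLe (π := fun _ => Y) s ω, ω (s + k)) ∂(chainLaw P μ) =
      ∫⁻ ω, ∫⁻ y, f (Preorder.frestrictLe (π := fun _ => Y) s ω, y) ∂((P ^ k) (ω s))
        ∂(chainLaw P μ) := by
  induction k generalizing f with
  | zero =>
    refine lintegral_congr fun ω => ?_
    rw [pow_zero]
    change _ = ∫⁻ y, _ ∂(Kernel.id (ω s))
    rw [Kernel.id_apply, lintegral_dirac' _ (by fun_prop), add_zero]
  | succ k ih =>
    have h1 := lintegral_chainLaw_succ P μ (s + k)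
      (f := fun p => f (Preorder.frestrictLe₂ (π := fun _ => Y) (Nat.le_add_right s k) p.1, p.2))
      (hf.comp (((Preorder.measurable_frestrictLe₂ (X := fun _ => Y) _).comp
        measurable_fst).prodMk measurable_snd))
    have h2 := ih (f := fun p => ∫⁻ y, f (p.1, y) ∂(P p.2))
      (Measurable.lintegral_kernel_prod_right' (κ := P.comap Prod.snd measurable_snd)
        (f := fun q : (((i : Finset.Iic s) → Y) × Y) × Y => f (q.1.1, q.2)) (by fun_prop))
    refine (h1.trans h2).trans (lintegral_congr fun ω => ?_)
    rw [pow_succ']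
    change _ = ∫⁻ y, _ ∂((P ∘ₖ (P ^ k)) (ω s))
    rw [Kernel.lintegral_comp _ _ _ (by fun_prop)]

lemma chainLaw_map_eval [IsProbabilityMeasure μ] (k : ℕ) :
    (chainLaw P μ).map (fun ω => ω k) = lawAt P μ k := by
  refine Measure.ext_of_lintegral _ fun f hf => ?_
  have h := lintegral_chainLaw_add P μ 0 k (f := fun p => f p.2) (by fun_prop)
  rw [zero_add] at h
  rw [lintegral_map hf (by fun_prop), h, lawAt, Measure.lintegral_bind (by fun_prop)
    hf.aemeasurable]
  conv_rhs => rw [← chainLaw_map_zero P μ]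
  rw [lintegral_map hf.lintegral_kernel (by fun_prop)]

lemma chainLaw_map_prodMk [IsProbabilityMeasure μ] (s k : ℕ) :
    (chainLaw P μ).map (fun ω => (Preorder.frestrictLe (π := fun _ => Y) s ω, ω (s + k))) =
      ((chainLaw P μ).map (Preorder.frestrictLe (π := fun _ => Y) s)) ⊗ₘ
        ((P ^ k).comap (fun x : (i : Finset.Iic s) → Y => x ⟨s, Finset.mem_Iic.2 le_rfl⟩)
          (measurable_pi_apply _)) := by
  refine Measure.ext_of_lintegral _ fun f hf => ?_
  rw [lintegral_map hf (by fun_prop), lintegral_chainLaw_add P μ s k hf,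
    Measure.lintegral_compProd hf,
    lintegral_map (Measurable.lintegral_kernel_prod_right' hf) (by fun_prop)]
  rfl

lemma integral_chainLaw_add [IsProbabilityMeasure μ] (s k : ℕ)
    {f : ((i : Finset.Iic s) → Y) × Y → ℝ} (hf : Measurable f) {C : ℝ} (hC : ∀ p, |f p| ≤ C) :
    ∫ ω, f (Preorder.frestrictLe (π := fun _ => Y) s ω, ω (s + k)) ∂(chainLaw P μ) =
      ∫ ω, ∫ y, f (Preorder.frestrictLe (π := fun _ => Y) s ω, y) ∂((P ^ k) (ω s))
        ∂(chainLaw P μ) := by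
  have h := congrArg (fun ν => ∫ x, f x ∂ν) (chainLaw_map_prodMk P μ s k)
  have : IsProbabilityMeasure ((chainLaw P μ).map (Preorder.frestrictLe (π := fun _ => Y) s)) :=
    Measure.isProbabilityMeasure_map (by fun_prop)
  rw [Measure.integral_compProd (.of_bound hf.aestronglyMeasurable C (.of_forall hC)),
    integral_map (by fun_prop) hf.aestronglyMeasurable,
    integral_map (by fun_prop) (by
      exact (StronglyMeasurable.integral_kernel_prod_right'
        hf.stronglyMeasurable).aestronglyMeasurable)] at h
  exact h

end Chain

section Decoupling

variable {Y : Type*} [MeasurableSpace Y]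

lemma abs_integral_le_of_abs_le {α : Type*} [MeasurableSpace α] {ν : Measure α}
    [IsProbabilityMeasure ν] {f : α → ℝ} {C : ℝ} (h : ∀ x, |f x| ≤ C) : |∫ x, f x ∂ν| ≤ C := by
  have := norm_integral_le_of_norm_le_const (μ := ν) (f := f) (C := C) (.of_forall h)
  simpa using this

lemma measurable_update_prod {ι : Type*} [DecidableEq ι] (a : ι) :
    Measurable fun p : (ι → Y) × Y => Function.update p.1 a p.2 := by
  refine measurable_pi_lambda _ fun b => ?_
  by_cases hb : b = a
  · subst hb; simpa using measurable_snd
  · simp only [Function.update_of_ne hb]; fun_prop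

lemma map_update_pi {ι : Type*} [Fintype ι] [DecidableEq ι] (π : Measure Y)
    [IsProbabilityMeasure π] (a : ι) :
    ((Measure.pi fun _ : ι => π).prod π).map (fun p => Function.update p.1 a p.2) =
      Measure.pi fun _ : ι => π := by
  have hmeas := measurable_update_prod (Y := Y) a
  refine (Measure.pi_eq fun s hs => ?_).symm
  rw [Measure.map_apply hmeas (MeasurableSet.univ_pi hs)]
  have hpre : (fun p : (ι → Y) × Y => Function.update p.1 a p.2) ⁻¹' (Set.univ.pi s) =
      (Set.univ.pi (Function.update s a Set.univ)) ×ˢ (s a) := by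
    ext p
    simp only [Set.mem_preimage, Set.mem_pi, Set.mem_univ, true_implies, Set.mem_prod]
    constructor
    · refine fun h => ⟨fun b => ?_, by simpa using h a⟩
      by_cases hb : b = a
      · subst hb; simp
      · simpa [hb] using h b
    · rintro ⟨h, h'⟩ b
      by_cases hb : b = a
      · subst hb; simpa using h'
      · simpa [hb] using h b
  rw [hpre, Measure.prod_prod, Measure.pi_pi, ← Finset.mul_prod_erase _ _ (Finset.mem_univ a),
    ← Finset.mul_prod_erase Finset.univ (fun b => π (s b)) (Finset.mem_univ a)]
  simp only [Function.update_self, measure_univ, one_mul]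
  rw [mul_comm]
  congr 1
  refine Finset.prod_congr rfl fun b hb => ?_
  rw [Function.update_of_ne (Finset.ne_of_mem_erase hb)]

lemma integral_pi_update {ι : Type*} [Fintype ι] [DecidableEq ι] (π : Measure Y)
    [IsProbabilityMeasure π] (a : ι) {f : (ι → Y) → ℝ} (hf : Measurable f) {C : ℝ}
    (hC : ∀ z, |f z| ≤ C) :
    ∫ z, f z ∂(Measure.pi fun _ : ι => π) =
      ∫ z, ∫ y, f (Function.update z a y) ∂π ∂(Measure.pi fun _ : ι => π) := by
  have hmeas := measurable_update_prod (Y := Y) a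
  conv_lhs => rw [← map_update_pi π a]
  rw [integral_map hmeas.aemeasurable hf.aestronglyMeasurable, integral_prod]
  exact .of_bound (hf.comp hmeas).aestronglyMeasurable C (.of_forall fun _ => hC _)

variable {P : Kernel Y Y} [IsMarkovKernel P] {π : Measure Y} {V : Y → ℝ} {ρ : ℕ → ℝ}

lemma ErgodicityAssumption.integrable_V (hA : ErgodicityAssumption P π V ρ) : Integrable V π := by
  refine ⟨hA.measurable_V.aestronglyMeasurable, ?_⟩
  rw [hasFiniteIntegral_iff_ofReal (.of_forall fun y => zero_le_one.trans (hA.one_le_V y))]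
  exact hA.moment_pi

lemma lintegral_V_chainLaw_le (hA : ErgodicityAssumption P π V ρ) (μ : Measure Y)
    [IsProbabilityMeasure μ] (k : ℕ) :
    ∫⁻ ω, ENNReal.ofReal (V (ω k)) ∂(chainLaw P μ) ≤ supMoment P μ V := by
  have h : ∫⁻ ω, ENNReal.ofReal (V (ω k)) ∂(chainLaw P μ) = vMoment (lawAt P μ k) V := by
    rw [vMoment, ← chainLaw_map_eval, lintegral_map hA.measurable_V.ennreal_ofReal (by fun_prop)]
  rw [h]
  exact le_iSup (fun k => vMoment (lawAt P μ k) V) k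

lemma integrable_V_chainLaw (hA : ErgodicityAssumption P π V ρ) {μ : Measure Y}
    [IsProbabilityMeasure μ] (hμ : supMoment P μ V < ∞) (k : ℕ) :
    Integrable (fun ω => V (ω k)) (chainLaw P μ) := by
  refine ⟨(hA.measurable_V.comp (measurable_pi_apply k)).aestronglyMeasurable, ?_⟩
  rw [hasFiniteIntegral_iff_ofReal (.of_forall fun y => zero_le_one.trans (hA.one_le_V _))]
  exact (lintegral_V_chainLaw_le hA μ k).trans_lt hμ

lemma integral_V_chainLaw_le (hA : ErgodicityAssumption P π V ρ) {μ : Measure Y}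
    [IsProbabilityMeasure μ] (hμ : supMoment P μ V < ∞) (k : ℕ) :
    ∫ ω, V (ω k) ∂(chainLaw P μ) ≤ (supMoment P μ V).toReal := by
  rw [integral_eq_lintegral_of_nonneg_ae
    (.of_forall fun y => zero_le_one.trans (hA.one_le_V _))
    (hA.measurable_V.comp (measurable_pi_apply k)).aestronglyMeasurable]
  exact ENNReal.toReal_mono hμ.ne (lintegral_V_chainLaw_le hA μ k)

lemma abs_integral_pow_sub_le (hA : ErgodicityAssumption P π V ρ) {f : Y → ℝ} (hf : Measurable f)
    {T : ℝ} (hT : 0 < T) (hfT : ∀ y, |f y| ≤ T) (x : Y) (k : ℕ) :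
    |∫ y, f y ∂((P ^ k) x) - ∫ y, f y ∂π| ≤ T * ρ k * (V x + ∫ y, V y ∂π) := by
  have hπ := hA.isProbabilityMeasure
  have hVx : 0 ≤ V x := zero_le_one.trans (hA.one_le_V x)
  have hVπ : 0 ≤ ∫ y, V y ∂π := integral_nonneg fun y => zero_le_one.trans (hA.one_le_V y)
  have h := hA.contraction (Measure.dirac x) π inferInstance hπ k
  rw [lawAt_dirac, lawAt_of_invariant P hA.invariant] at h
  have h1 : ENNReal.ofReal |∫ y, T⁻¹ * f y ∂((P ^ k) x) - ∫ y, T⁻¹ * f y ∂π| ≤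
      tvNorm ((P ^ k) x) π := by
    refine le_iSup_of_le (fun y => T⁻¹ * f y) (le_iSup_of_le (by fun_prop)
      (le_iSup_of_le (fun y => ?_) le_rfl))
    rw [abs_mul, abs_of_pos (inv_pos.2 hT), inv_mul_le_iff₀ hT, mul_one]
    exact hfT y
  have h2 : vMoment (Measure.dirac x) V = ENNReal.ofReal (V x) :=
    lintegral_dirac' _ hA.measurable_V.ennreal_ofReal
  have h3 : vMoment π V = ENNReal.ofReal (∫ y, V y ∂π) :=
    (ofReal_integral_eq_lintegral_ofReal hA.integrable_V
      (.of_forall fun y => zero_le_one.trans (hA.one_le_V y))).symm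
  have h4 := h1.trans h
  rw [h2, h3, ← ENNReal.ofReal_add hVx hVπ, ← ENNReal.ofReal_mul (hA.rho_nonneg k),
    ENNReal.ofReal_le_ofReal_iff (mul_nonneg (hA.rho_nonneg k) (add_nonneg hVx hVπ)),
    integral_const_mul, integral_const_mul, ← mul_sub, abs_mul, abs_of_pos (inv_pos.2 hT),
    inv_mul_le_iff₀ hT] at h4
  rwa [mul_assoc]

lemma abs_integral_chainLaw_sub_le (hA : ErgodicityAssumption P π V ρ) {μ : Measure Y}
    [IsProbabilityMeasure μ] (hμ : supMoment P μ V < ∞) (s k : ℕ)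
    {f : ((i : Finset.Iic s) → Y) × Y → ℝ} (hf : Measurable f) {T : ℝ} (hT : 0 < T)
    (hfT : ∀ p, |f p| ≤ T) :
    |∫ ω, f (Preorder.frestrictLe (π := fun _ => Y) s ω, ω (s + k)) ∂(chainLaw P μ) -
      ∫ ω, ∫ y, f (Preorder.frestrictLe (π := fun _ => Y) s ω, y) ∂π ∂(chainLaw P μ)| ≤
      T * ρ k * ((supMoment P μ V).toReal + ∫ y, V y ∂π) := by
  have hπ := hA.isProbabilityMeasure
  rw [integral_chainLaw_add P μ s k hf hfT]
  have hi1 : Integrable (fun ω => ∫ y, f (Preorder.frestrictLe (π := fun _ => Y) s ω, y)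
      ∂((P ^ k) (ω s))) (chainLaw P μ) := by
    refine .of_bound (C := T) ?_ (.of_forall fun ω => ?_)
    · have := StronglyMeasurable.integral_kernel_prod_right' (f := f)
        (κ := (P ^ k).comap (fun x : (i : Finset.Iic s) → Y => x ⟨s, Finset.mem_Iic.2 le_rfl⟩)
          (measurable_pi_apply _)) hf.stronglyMeasurable
      exact (this.comp_measurable (Preorder.measurable_frestrictLe
        (X := fun _ => Y) s)).aestronglyMeasurable
    · exact abs_integral_le_of_abs_le fun y => hfT (Preorder.frestrictLe (π := fun _ => Y) s ω, y)
  have hi2 : Integrable (fun ω => ∫ y, f (Preorder.frestrictLe (π := fun _ => Y) s ω, y) ∂π)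
      (chainLaw P μ) := by
    refine .of_bound (C := T) ?_ (.of_forall fun ω => ?_)
    · exact (hf.stronglyMeasurable.integral_prod_right'.comp_measurable
        (Preorder.measurable_frestrictLe (X := fun _ => Y) s)).aestronglyMeasurable
    · exact abs_integral_le_of_abs_le fun y => hfT (Preorder.frestrictLe (π := fun _ => Y) s ω, y)
  have hiV : Integrable (fun ω : ℕ → Y => V (ω s) + ∫ y, V y ∂π) (chainLaw P μ) :=
    (integrable_V_chainLaw hA hμ s).add (integrable_const _)
  rw [← integral_sub hi1 hi2]
  calc _ ≤ ∫ ω, T * ρ k * (V (ω s) + ∫ y, V y ∂π) ∂(chainLaw P μ) := by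
        rw [← Real.norm_eq_abs]
        refine norm_integral_le_of_norm_le (hiV.const_mul _) (.of_forall fun ω => ?_)
        exact abs_integral_pow_sub_le hA (f := fun y =>
          f (Preorder.frestrictLe (π := fun _ => Y) s ω, y)) (by fun_prop) hT (fun _ => hfT _) _ _
    _ = T * ρ k * (∫ ω, V (ω s) ∂(chainLaw P μ) + ∫ y, V y ∂π) := by
        rw [integral_const_mul, integral_add (integrable_V_chainLaw hA hμ s) (integrable_const _)]
        simp
    _ ≤ _ := by
        have := hA.rho_nonneg k
        gcongr
        exact integral_V_chainLaw_le hA hμ s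

/-- Along times that are at least `L` apart from each other and from the origin, the chain is close
to an independent sample of the stationary distribution. -/
lemma abs_integral_chainLaw_sub_integral_pi_le (hA : ErgodicityAssumption P π V ρ) {μ : Measure Y}
    [IsProbabilityMeasure μ] (hμ : supMoment P μ V < ∞) {ι : Type*} [Fintype ι]
    {L : ℕ} (hL : 0 < L) {i : ι → ℕ} (hi0 : ∀ a, L ≤ i a)
    (hi : ∀ a b, a ≠ b → i a + L ≤ i b ∨ i b + L ≤ i a)
    {g : (ι → Y) → ℝ} (hg : Measurable g) {T : ℝ} (hT : 0 < T) (hgT : ∀ y, |g y| ≤ T) :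
    |∫ ω, g (fun a => ω (i a)) ∂(chainLaw P μ) - ∫ y, g y ∂(Measure.pi fun _ : ι => π)| ≤
      Fintype.card ι * (T * ρ L * ((supMoment P μ V).toReal + ∫ y, V y ∂π)) := by
  classical
  have hπ := hA.isProbabilityMeasure
  set B := T * ρ L * ((supMoment P μ V).toReal + ∫ y, V y ∂π) with hB
  let mix : ℕ → (ι → Y) × (ℕ → Y) → (ι → Y) :=
    fun t p a => if i a < t then p.2 (i a) else p.1 a
  have hmix : ∀ t, Measurable (mix t) := fun t => by
    refine measurable_pi_lambda _ fun a => ?_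
    by_cases h : i a < t
    · simp only [mix, h, if_true]; fun_prop
    · simp only [mix, h, if_false]; fun_prop
  let Φ : ℕ → (ι → Y) → ℝ := fun t z => ∫ ω, g (mix t (z, ω)) ∂(chainLaw P μ)
  have hΦm : ∀ t, Measurable (Φ t) := fun t =>
    ((hg.comp (hmix t)).stronglyMeasurable.integral_prod_right' (ν := chainLaw P μ)).measurable
  have hΦT : ∀ t z, |Φ t z| ≤ T := fun t z => by
    exact abs_integral_le_of_abs_le fun ω => hgT (mix t (z, ω))
  have hΦi : ∀ t, Integrable (Φ t) (Measure.pi fun _ : ι => π) := fun t =>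
    .of_bound (hΦm t).aestronglyMeasurable T (.of_forall (hΦT t))
  let I : ℕ → ℝ := fun t => ∫ z, Φ t z ∂(Measure.pi fun _ : ι => π)
  have hstep : ∀ t, |I (t + 1) - I t| ≤ (Finset.univ.filter fun a => i a = t).card * B := by
    intro t
    by_cases hex : ∃ a₀, i a₀ = t
    · obtain ⟨a₀, ha₀⟩ := hex
      have hfilt : (Finset.univ.filter fun a => i a = t) = {a₀} := by
        ext a
        simp only [Finset.mem_filter, Finset.mem_univ, true_and, Finset.mem_singleton]
        refine ⟨fun ha => ?_, fun ha => ha ▸ ha₀⟩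
        by_contra hne
        rcases hi a a₀ hne with h | h <;> omega
      obtain ⟨s, rfl⟩ : ∃ s, t = s + L := ⟨t - L, by have := hi0 a₀; omega⟩
      have hlt : ∀ a, a ≠ a₀ → (i a < s + L ↔ i a ≤ s) := fun a ha => by
        rcases hi a a₀ ha with h | h <;> omega
      have hlt' : ∀ a, a ≠ a₀ → (i a < s + L + 1 ↔ i a ≤ s) := fun a ha => by
        rcases hi a a₀ ha with h | h <;> omega
      let F : (ι → Y) → ((j : Finset.Iic s) → Y) × Y → ℝ := fun z p =>
        g fun a => if a = a₀ then p.2 else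
          if h : i a ≤ s then p.1 ⟨i a, Finset.mem_Iic.2 h⟩ else z a
      have hF : ∀ z, Measurable (F z) := fun z => by
        refine hg.comp (measurable_pi_lambda _ fun a => ?_)
        by_cases h1 : a = a₀
        · simpa [h1] using measurable_snd
        · by_cases h2 : i a ≤ s
          · simp only [h1, h2, if_false, dif_pos]; fun_prop
          · simp [h1, h2]
      have e1 : ∀ z ω, g (mix (s + L + 1) (z, ω)) =
          F z (Preorder.frestrictLe (π := fun _ => Y) s ω, ω (s + L)) := fun z ω => by
        refine congrArg g (funext fun a => ?_)
        by_cases h1 : a = a₀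
        · subst h1; simp [mix, ha₀]
        · simp [mix, h1, hlt' a h1]
      have e2 : ∀ z ω y, g (mix (s + L) (Function.update z a₀ y, ω)) =
          F z (Preorder.frestrictLe (π := fun _ => Y) s ω, y) := fun z ω y => by
        refine congrArg g (funext fun a => ?_)
        by_cases h1 : a = a₀
        · subst h1; simp [mix, ha₀]
        · simp [mix, h1, hlt a h1]
      have e3 : ∀ z, ∫ y, Φ (s + L) (Function.update z a₀ y) ∂π =
          ∫ ω, ∫ y, F z (Preorder.frestrictLe (π := fun _ => Y) s ω, y) ∂π ∂(chainLaw P μ) :=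
        fun z => by
          simp only [Φ, e2]
          refine integral_integral_swap ?_
          refine .of_bound (C := T) ?_ (.of_forall fun _ => hgT _)
          exact ((hF z).comp (((Preorder.measurable_frestrictLe (X := fun _ => Y) s).comp
            measurable_snd).prodMk measurable_fst)).aestronglyMeasurable
      have e4 : I (s + L) = ∫ z, ∫ ω, ∫ y, F z (Preorder.frestrictLe (π := fun _ => Y) s ω, y) ∂π
          ∂(chainLaw P μ) ∂(Measure.pi fun _ : ι => π) := by
        simp only [I]
        rw [integral_pi_update π a₀ (hΦm _) (hΦT _)]
        simp only [e3]
      have hi4 : Integrable (fun z => ∫ ω, ∫ y, F z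
          (Preorder.frestrictLe (π := fun _ => Y) s ω, y) ∂π ∂(chainLaw P μ))
          (Measure.pi fun _ : ι => π) := by
        simp only [← e3]
        have hupd := measurable_update_prod (Y := Y) a₀
        refine .of_bound (C := T) ?_ (.of_forall fun z => ?_)
        · exact (((hΦm (s + L)).comp hupd).stronglyMeasurable.integral_prod_right'
            (ν := π)).aestronglyMeasurable
        · exact abs_integral_le_of_abs_le fun y => hΦT (s + L) (Function.update z a₀ y)
      rw [e4, hfilt, Finset.card_singleton, Nat.cast_one, one_mul, ← integral_sub (hΦi _) hi4]
      have := norm_integral_le_of_norm_le_const (μ := Measure.pi fun _ : ι => π) (C := B)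
        (f := fun z => Φ (s + L + 1) z - ∫ ω, ∫ y, F z
          (Preorder.frestrictLe (π := fun _ => Y) s ω, y) ∂π ∂(chainLaw P μ))
        (.of_forall fun z => by
          simp only [Φ, e1]
          exact abs_integral_chainLaw_sub_le hA hμ s L (hF z) hT fun _ => hgT _)
      simpa using this
    · have hne : ∀ a, i a ≠ t := fun a ha => hex ⟨a, ha⟩
      have hmm : mix (t + 1) = mix t := by
        funext p a
        have : i a < t + 1 ↔ i a < t := by have := hne a; omega
        simp [mix, this]
      simp [I, Φ, hmm, hne]
  have hsum : ∀ N, |I N - I 0| ≤ (∑ t ∈ Finset.range N,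
      ((Finset.univ.filter fun a => i a = t).card : ℝ)) * B := by
    intro N
    rw [← Finset.sum_range_sub, Finset.sum_mul]
    exact (Finset.abs_sum_le_sum_abs _ _).trans (Finset.sum_le_sum fun t _ => hstep t)
  set N := (∑ a, i a) + 1 with hN
  have hiN : ∀ a, i a < N := fun a =>
    Nat.lt_succ_of_le (Finset.single_le_sum (f := i) (fun _ _ => Nat.zero_le _)
      (Finset.mem_univ a))
  have hcard : ∑ t ∈ Finset.range N, ((Finset.univ.filter fun a => i a = t).card : ℝ) =
      Fintype.card ι := by
    rw [← Nat.cast_sum, ← Finset.card_eq_sum_card_fiberwise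
      (fun a _ => by simpa using hiN a), Finset.card_univ]
  have hIN : I N = ∫ ω, g (fun a => ω (i a)) ∂(chainLaw P μ) := by
    simp [I, Φ, mix, hiN]
  have hI0 : I 0 = ∫ y, g y ∂(Measure.pi fun _ : ι => π) := by
    simp [I, Φ, mix]
  rw [← hIN, ← hI0, ← hcard]
  exact hsum N

end Decoupling

section Counting

lemma mem_tuples {m n : ℕ} {i : Fin m → ℕ} :
    i ∈ tuples m n ↔ (∀ a, 1 ≤ i a ∧ i a ≤ n) ∧ StrictMono i := by
  simp [tuples, Fintype.mem_piFinset, StrictMono]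

lemma tuples_mono (m : ℕ) {n n' : ℕ} (h : n ≤ n') : tuples m n ⊆ tuples m n' := fun i hi => by
  rw [mem_tuples] at hi ⊢
  exact ⟨fun a => ⟨(hi.1 a).1, (hi.1 a).2.trans h⟩, hi.2⟩

lemma card_tuples (m n : ℕ) : (tuples m n).card = n.choose m := by
  have h : (Finset.powersetCard m (Finset.Icc 1 n)).card = n.choose m := by simp
  rw [← h]
  refine Finset.card_bij' (fun i _ => Finset.univ.image i)
    (fun s hs => s.orderEmbOfFin (Finset.mem_powersetCard.1 hs).2) ?_ ?_ ?_ ?_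
  · intro i hi
    rw [mem_tuples] at hi
    rw [Finset.mem_powersetCard, Finset.card_image_of_injective _ hi.2.injective]
    refine ⟨fun x hx => ?_, by simp⟩
    obtain ⟨a, -, rfl⟩ := Finset.mem_image.1 hx
    exact Finset.mem_Icc.2 (hi.1 a)
  · intro s hs
    rw [mem_tuples]
    refine ⟨fun a => ?_, (s.orderEmbOfFin _).strictMono⟩
    exact Finset.mem_Icc.1 ((Finset.mem_powersetCard.1 hs).1 (Finset.orderEmbOfFin_mem _ _ a))
  · intro i hi
    rw [mem_tuples] at hi
    exact (Finset.orderEmbOfFin_unique _ (fun a => Finset.mem_image_of_mem _ (Finset.mem_univ a))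
      hi.2).symm
  · intro s hs
    exact Finset.image_orderEmbOfFin_univ _ _

variable {ι : Type*} [Fintype ι] [DecidableEq ι]

/-- If, the other coordinates being fixed, at most `c` values of the coordinate `a` satisfy `Q`,
then `Q` holds for at most `c * n ^ (p - 1)` of the `p`-tuples. -/
lemma card_filter_piFinset_mul_le (n c : ℕ) (a : ι) (Q : (ι → ℕ) → Prop) [DecidablePred Q]
    (hQ : ∀ k, ((Finset.Icc 1 n).filter fun v => Q (Function.update k a v)).card ≤ c) :
    ((Fintype.piFinset fun _ : ι => Finset.Icc 1 n).filter Q).card * n ≤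
      n ^ Fintype.card ι * c := by
  have hc : (Fintype.piFinset fun _ : ι => Finset.Icc 1 n).card = n ^ Fintype.card ι := by simp
  have h1 : ((Fintype.piFinset fun _ : ι => Finset.Icc 1 n).sigma
      fun k => (Finset.Icc 1 n).filter fun v => Q (Function.update k a v)).card ≤
      n ^ Fintype.card ι * c := by
    rw [Finset.card_sigma, ← hc, ← smul_eq_mul]
    exact Finset.sum_le_card_nsmul _ _ _ fun k _ => hQ k
  refine le_trans ?_ h1
  have h2 : ((Fintype.piFinset fun _ : ι => Finset.Icc 1 n).filter Q).card * n =
      (((Fintype.piFinset fun _ : ι => Finset.Icc 1 n).filter Q) ×ˢ Finset.Icc 1 n).card := by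
    rw [Finset.card_product]; simp
  rw [h2]
  refine Finset.card_le_card_of_injOn (fun p => ⟨Function.update p.1 a p.2, p.1 a⟩) ?_ ?_
  · rintro ⟨k, v⟩ hk
    simp only [Finset.coe_product, Set.mem_prod, Finset.mem_coe, Finset.mem_filter,
      Fintype.mem_piFinset] at hk
    simp only [Finset.mem_coe, Finset.mem_sigma, Fintype.mem_piFinset, Finset.mem_filter,
      Function.update_idem, Function.update_eq_self]
    refine ⟨fun b => ?_, hk.1.1 a, hk.1.2⟩
    by_cases hb : b = a
    · subst hb; simpa using hk.2
    · simpa [hb] using hk.1.1 b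
  · rintro ⟨k, v⟩ - ⟨k', v'⟩ - hkk
    simp only [Sigma.mk.injEq, heq_eq_eq] at hkk
    obtain ⟨h3, h4⟩ := hkk
    have h5 : v = v' := by simpa using congrFun h3 a
    have h6 : k = k' := by
      funext b
      by_cases hb : b = a
      · subst hb; exact h4
      · simpa [hb] using congrFun h3 b
    rw [h5, h6]

/-- The indices are at distance at least `L` from each other and from `0`. -/
def IsSeparated (L : ℕ) (k : ι → ℕ) : Prop :=
  (∀ a, L ≤ k a) ∧ ∀ a b, a ≠ b → k a + L ≤ k b ∨ k b + L ≤ k a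

open Classical in
lemma card_not_isSeparated_mul_le (n L : ℕ) :
    ((Fintype.piFinset fun _ : ι => Finset.Icc 1 n).filter fun k => ¬ IsSeparated L k).card * n ≤
      n ^ Fintype.card ι * (3 * Fintype.card ι ^ 2 * L) := by
  set S := Fintype.piFinset fun _ : ι => Finset.Icc 1 n with hS
  have hsub : (S.filter fun k => ¬ IsSeparated L k) ⊆
      (Finset.univ.biUnion fun a : ι => S.filter fun k => k a < L) ∪
      ((Finset.univ.filter fun p : ι × ι => p.1 ≠ p.2).biUnion fun p =>
        S.filter fun k => k p.1 < k p.2 + L ∧ k p.2 < k p.1 + L) := by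
    intro k hk
    rw [Finset.mem_filter, IsSeparated] at hk
    obtain ⟨hkS, hk⟩ := hk
    rw [Finset.mem_union, Finset.mem_biUnion, Finset.mem_biUnion]
    by_contra! hcon
    refine hk ⟨fun a => ?_, fun a b hab => ?_⟩
    · by_contra hlt
      exact hcon.1 a (Finset.mem_univ a) (Finset.mem_filter.2 ⟨hkS, not_le.1 hlt⟩)
    · by_contra hlt
      exact hcon.2 (a, b) (by simpa using hab)
        (Finset.mem_filter.2 ⟨hkS, by simp only; omega⟩)
  have h1 : ∀ a : ι, (S.filter fun k => k a < L).card * n ≤ n ^ Fintype.card ι * L := fun a => by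
    refine card_filter_piFinset_mul_le n L a _ fun k => ?_
    calc _ ≤ (Finset.range L).card := Finset.card_le_card fun v hv => by
          simpa using (Finset.mem_filter.1 hv).2
      _ = L := by simp
  have h2 : ∀ p : ι × ι, p.1 ≠ p.2 →
      (S.filter fun k => k p.1 < k p.2 + L ∧ k p.2 < k p.1 + L).card * n ≤
      n ^ Fintype.card ι * (2 * L) := fun p hp => by
    refine card_filter_piFinset_mul_le n (2 * L) p.1 _ fun k => ?_
    calc _ ≤ (Finset.Ico (k p.2 + 1 - L) (k p.2 + L)).card := Finset.card_le_card fun v hv => by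
          have := (Finset.mem_filter.1 hv).2
          rw [Function.update_self, Function.update_of_ne hp.symm] at this
          rw [Finset.mem_Ico]; omega
      _ ≤ 2 * L := by rw [Nat.card_Ico]; omega
  set c := Fintype.card ι with hc
  calc _ ≤ (∑ a : ι, (S.filter fun k => k a < L).card +
        ∑ p ∈ Finset.univ.filter (fun p : ι × ι => p.1 ≠ p.2),
          (S.filter fun k => k p.1 < k p.2 + L ∧ k p.2 < k p.1 + L).card) * n := by
        gcongr
        exact (Finset.card_le_card hsub).trans ((Finset.card_union_le _ _).trans
          (add_le_add Finset.card_biUnion_le Finset.card_biUnion_le))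
    _ ≤ ∑ a : ι, n ^ c * L + ∑ p : ι × ι, n ^ c * (2 * L) := by
        rw [add_mul, Finset.sum_mul, Finset.sum_mul]
        refine add_le_add (Finset.sum_le_sum fun a _ => h1 a) ?_
        exact (Finset.sum_le_sum fun p hp => h2 p (Finset.mem_filter.1 hp).2).trans
          (Finset.sum_le_sum_of_subset (Finset.filter_subset _ _))
    _ = n ^ c * (c * L + c ^ 2 * (2 * L)) := by
        simp only [Finset.sum_const, Finset.card_univ, Fintype.card_prod, smul_eq_mul, ← hc]
        ring
    _ ≤ n ^ c * (3 * c ^ 2 * L) := by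
        have : c ≤ c ^ 2 := Nat.le_self_pow (by norm_num) c
        gcongr
        nlinarith

end Counting

section SecondMoment

variable {Y : Type*} [MeasurableSpace Y]
  {P : Kernel Y Y} [IsMarkovKernel P] {π : Measure Y} {V : Y → ℝ} {ρ : ℕ → ℝ}

lemma exists_rho_mul_le (hA : ErgodicityAssumption P π V ρ) {r : ℝ} (hr : 1 < r)
    (hρ : ρ =O[atTop] fun n : ℕ => (n : ℝ) ^ (-r)) :
    ∃ R : ℝ, 0 ≤ R ∧ ∀ k : ℕ, ρ k * (k + 1) ≤ R := by
  obtain ⟨C, hC⟩ := hρ.bound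
  obtain ⟨N, hN⟩ := eventually_atTop.1 hC
  refine ⟨max (ρ 0 * (N + 1 + 1)) (2 * |C|), le_max_of_le_right (by positivity), fun k => ?_⟩
  by_cases hk : k ≤ N + 1
  · refine le_max_of_le_left ?_
    have h0 := hA.rho_nonneg 0
    have : (k : ℝ) ≤ N + 1 := by exact_mod_cast hk
    exact mul_le_mul (hA.rho_antitone (Nat.zero_le k)) (by linarith) (by positivity) h0
  · refine le_max_of_le_right ?_
    have hk1 : (1 : ℝ) ≤ k := by exact_mod_cast (by omega : 1 ≤ k)
    have h := hN k (by omega)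
    rw [Real.norm_of_nonneg (hA.rho_nonneg k), Real.norm_of_nonneg (by positivity)] at h
    have h1 : (k : ℝ) ^ (-r) ≤ (k : ℝ)⁻¹ := by
      rw [← Real.rpow_neg_one]
      exact Real.rpow_le_rpow_of_exponent_le hk1 (by linarith)
    have h2 : ρ k ≤ |C| * (k : ℝ)⁻¹ :=
      h.trans (mul_le_mul (le_abs_self C) h1 (by positivity) (abs_nonneg C))
    calc ρ k * (k + 1) ≤ |C| * (k : ℝ)⁻¹ * (2 * k) := by
          refine mul_le_mul h2 (by linarith) (by positivity) (by positivity)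
      _ = 2 * |C| := by field_simp

lemma integral_pi_sum_mul {ι κ : Type*} [Fintype ι] [Fintype κ] (π : Measure Y)
    [IsProbabilityMeasure π] (f : (ι → Y) → ℝ) (g : (κ → Y) → ℝ) :
    ∫ y, f (fun a => y (Sum.inl a)) * g (fun b => y (Sum.inr b))
      ∂(Measure.pi fun _ : ι ⊕ κ => π) =
      (∫ y, f y ∂(Measure.pi fun _ : ι => π)) * ∫ y, g y ∂(Measure.pi fun _ : κ => π) := by
  rw [← integral_prod_mul]
  exact (measurePreserving_sumPiEquivProdPi (fun _ : ι ⊕ κ => π)).integral_comp'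
    (fun p : (ι → Y) × (κ → Y) => f p.1 * g p.2)

/-- The second moment of the centred, unnormalised `U`-statistic with a bounded kernel. -/
lemma exists_integral_sq_le (hA : ErgodicityAssumption P π V ρ) {r : ℝ} (hr : 1 < r)
    (hρ : ρ =O[atTop] fun n : ℕ => (n : ℝ) ^ (-r)) {μ : Measure Y} [IsProbabilityMeasure μ]
    (hμ : supMoment P μ V < ∞) (m : ℕ) :
    ∃ C : ℝ, 0 ≤ C ∧ ∀ n : ℕ, 1 ≤ n → ∀ T : ℝ, 0 < T → ∀ g : (Fin m → Y) → ℝ, Measurable g →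
      (∀ y, |g y| ≤ T) →
      ∫ ω, (∑ i ∈ tuples m n, (g (fun j => ω (i j)) - ∫ y, g y ∂(Measure.pi fun _ : Fin m => π))) ^ 2
        ∂(chainLaw P μ) ≤ C * T ^ 2 * ((n : ℝ) ^ m) ^ 2 / √n := by
  classical
  have hπ := hA.isProbabilityMeasure
  obtain ⟨R, hR0, hR⟩ := exists_rho_mul_le hA hr hρ
  set D := (supMoment P μ V).toReal + ∫ y, V y ∂π with hD
  have hD0 : 0 ≤ D := add_nonneg ENNReal.toReal_nonneg
    (integral_nonneg fun y => zero_le_one.trans (hA.one_le_V y))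
  refine ⟨8 * m * R * D + 48 * m ^ 2, by positivity, fun n hn T hT g hg hgT => ?_⟩
  set c := ∫ y, g y ∂(Measure.pi fun _ : Fin m => π) with hc
  have hcT : |c| ≤ T := abs_integral_le_of_abs_le hgT
  let f : (Fin m → Y) → ℝ := fun y => g y - c
  have hf : Measurable f := hg.sub_const c
  have hfT : ∀ y, |f y| ≤ 2 * T := fun y =>
    (abs_sub _ _).trans (by have := hgT y; linarith)
  have hf0 : ∫ y, f y ∂(Measure.pi fun _ : Fin m => π) = 0 := by
    simp only [f]
    rw [integral_sub (.of_bound hg.aestronglyMeasurable T (.of_forall hgT)) (integrable_const _)]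
    simp [hc]
  let G : (Fin m ⊕ Fin m → Y) → ℝ := fun y => f (fun a => y (Sum.inl a)) * f (fun a => y (Sum.inr a))
  have hG : Measurable G := by
    refine (hf.comp ?_).mul (hf.comp ?_) <;> exact measurable_pi_lambda _ fun a => by fun_prop
  have hGT : ∀ y, |G y| ≤ 4 * T ^ 2 := fun y => by
    rw [abs_mul]
    calc _ ≤ (2 * T) * (2 * T) := mul_le_mul (hfT _) (hfT _) (abs_nonneg _) (by positivity)
      _ = _ := by ring
  have hG0 : ∫ y, G y ∂(Measure.pi fun _ : Fin m ⊕ Fin m => π) = 0 := by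
    simp only [G]
    rw [integral_pi_sum_mul, hf0, zero_mul]
  set L := Nat.sqrt n with hLdef
  have hL : 0 < L := Nat.sqrt_pos.2 hn
  let S := Fintype.piFinset fun _ : Fin m ⊕ Fin m => Finset.Icc 1 n
  let E : (Fin m ⊕ Fin m → ℕ) → ℝ := fun k => ∫ ω, G (fun a => ω (k a)) ∂(chainLaw P μ)
  have hEbad : ∀ k, |E k| ≤ 4 * T ^ 2 := fun k => abs_integral_le_of_abs_le fun ω : ℕ → Y => hGT fun a => ω (k a)
  have hEgood : ∀ k, IsSeparated L k → |E k| ≤ 2 * m * (4 * T ^ 2 * ρ L * D) := fun k hk => by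
    have h := abs_integral_chainLaw_sub_integral_pi_le hA hμ hL hk.1 hk.2 hG
      (by positivity : 0 < 4 * T ^ 2) hGT
    rw [hG0, sub_zero] at h
    refine h.trans_eq ?_
    simp only [Fintype.card_sum, Fintype.card_fin]
    push_cast; ring
  have hexp : ∫ ω, (∑ i ∈ tuples m n, f (fun j => ω (i j))) ^ 2 ∂(chainLaw P μ) =
      ∑ p ∈ tuples m n ×ˢ tuples m n, E (Sum.elim p.1 p.2) := by
    have : ∀ ω : ℕ → Y, (∑ i ∈ tuples m n, f (fun j => ω (i j))) ^ 2 =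
        ∑ p ∈ tuples m n ×ˢ tuples m n, G (fun a => ω (Sum.elim p.1 p.2 a)) := fun ω => by
      rw [sq, Finset.sum_mul_sum, Finset.sum_product]
      rfl
    simp only [this]
    refine integral_finsetSum _ fun p _ => .of_bound (C := 4 * T ^ 2) ?_
      (.of_forall fun ω => hGT fun a => ω (Sum.elim p.1 p.2 a))
    have hcoord : Measurable fun (ω : ℕ → Y) (a : Fin m ⊕ Fin m) => ω (Sum.elim p.1 p.2 a) :=
      measurable_pi_lambda _ fun a => measurable_pi_apply _
    exact (hG.comp hcoord).aestronglyMeasurable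
  have hinj : Set.InjOn (fun p : (Fin m → ℕ) × (Fin m → ℕ) => Sum.elim p.1 p.2)
      (tuples m n ×ˢ tuples m n : Finset _) := by
    rintro ⟨i, j⟩ - ⟨i', j'⟩ - h
    have h1 := congrArg (fun k => k ∘ Sum.inl) h
    have h2 := congrArg (fun k => k ∘ Sum.inr) h
    simp only [Sum.elim_comp_inl, Sum.elim_comp_inr] at h1 h2
    rw [h1, h2]
  have hsub : (tuples m n ×ˢ tuples m n).image (fun p => Sum.elim p.1 p.2) ⊆ S := by
    intro k hk
    obtain ⟨p, hp, rfl⟩ := Finset.mem_image.1 hk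
    rw [Finset.mem_product, mem_tuples, mem_tuples] at hp
    refine Fintype.mem_piFinset.2 ?_
    rintro (a | a)
    · exact Finset.mem_Icc.2 (hp.1.1 a)
    · exact Finset.mem_Icc.2 (hp.2.1 a)
  have hn0 : (0 : ℝ) < n := by exact_mod_cast hn
  have hs0 : 0 < √(n : ℝ) := Real.sqrt_pos.2 hn0
  have hcardS : (S.card : ℝ) = ((n : ℝ) ^ m) ^ 2 := by
    simp only [S, Fintype.card_piFinset, Nat.card_Icc, Finset.prod_const, Finset.card_univ,
      Fintype.card_sum, Fintype.card_fin]
    push_cast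
    ring_nf
  have hbad : ((S.filter fun k => ¬ IsSeparated L k).card : ℝ) ≤
      ((n : ℝ) ^ m) ^ 2 * (12 * m ^ 2) / √n := by
    have h := card_not_isSeparated_mul_le (ι := Fin m ⊕ Fin m) n L
    simp only [Fintype.card_sum, Fintype.card_fin] at h
    have h' : ((S.filter fun k => ¬ IsSeparated L k).card : ℝ) * n ≤
        (n : ℝ) ^ (m + m) * (3 * (m + m) ^ 2 * L) := by exact_mod_cast h
    have hLs : (L : ℝ) ≤ √n := Real.nat_sqrt_le_real_sqrt
    rw [le_div_iff₀ hs0]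
    have h2 : (n : ℝ) = √n * √n := (Real.mul_self_sqrt hn0.le).symm
    refine le_of_mul_le_mul_right ?_ hs0
    rw [mul_assoc, ← h2]
    refine h'.trans ?_
    calc (n : ℝ) ^ (m + m) * (3 * (m + m) ^ 2 * L) = ((n : ℝ) ^ m) ^ 2 * (12 * m ^ 2) * L := by ring
      _ ≤ _ := by gcongr
  have hρL : ρ L ≤ R / √n := by
    rw [le_div_iff₀ hs0]
    refine le_trans ?_ (hR L)
    exact mul_le_mul_of_nonneg_left Real.real_sqrt_le_nat_sqrt_succ (hA.rho_nonneg L)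
  calc _ = ∑ k ∈ (tuples m n ×ˢ tuples m n).image (fun p => Sum.elim p.1 p.2), E k := by
        rw [hexp, Finset.sum_image hinj]
    _ ≤ ∑ k ∈ S, |E k| := (Finset.sum_le_sum fun k _ => le_abs_self _).trans
        (Finset.sum_le_sum_of_subset_of_nonneg hsub fun _ _ _ => abs_nonneg _)
    _ = ∑ k ∈ S.filter (IsSeparated L), |E k| + ∑ k ∈ S.filter (fun k => ¬ IsSeparated L k), |E k| :=
        (Finset.sum_filter_add_sum_filter_not _ _ _).symm
    _ ≤ ((n : ℝ) ^ m) ^ 2 * (2 * m * (4 * T ^ 2 * (R / √n) * D)) +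
          ((n : ℝ) ^ m) ^ 2 * (12 * m ^ 2) / √n * (4 * T ^ 2) := by
        refine add_le_add ?_ ?_
        · refine (Finset.sum_le_card_nsmul _ _ _ fun k hk =>
            hEgood k (Finset.mem_filter.1 hk).2).trans ?_
          rw [nsmul_eq_mul, ← hcardS]
          have := hA.rho_nonneg L
          gcongr
          exact Finset.filter_subset _ _
        · refine (Finset.sum_le_card_nsmul _ _ _ fun k _ => hEbad k).trans ?_
          rw [nsmul_eq_mul]
          gcongr
    _ = _ := by field_simp; ring

end SecondMoment

section Limits

lemma ae_tendsto_zero_of_summable_integral {Ω : Type*} [MeasurableSpace Ω] {ν : Measure Ω}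
    {Z : ℕ → Ω → ℝ} (hZ : ∀ k, Integrable (Z k) ν) (hZ0 : ∀ k ω, 0 ≤ Z k ω) {b : ℕ → ℝ}
    (hb : Summable b) (hZb : ∀ k, ∫ ω, Z k ω ∂ν ≤ b k) :
    ∀ᵐ ω ∂ν, Tendsto (fun k => Z k ω) atTop (𝓝 0) := by
  have hmeas : ∀ k, AEMeasurable (fun ω => ENNReal.ofReal (Z k ω)) ν := fun k =>
    (hZ k).aemeasurable.ennreal_ofReal
  have hXint : ∀ k, ∫⁻ ω, ENNReal.ofReal (Z k ω) ∂ν ≤ ENNReal.ofReal (b k) := fun k => by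
    rw [← ofReal_integral_eq_lintegral_ofReal (hZ k) (.of_forall (hZ0 k))]
    exact ENNReal.ofReal_le_ofReal (hZb k)
  have hfin : ∫⁻ ω, ∑' k, ENNReal.ofReal (Z k ω) ∂ν ≠ ∞ := by
    rw [lintegral_tsum hmeas]
    exact ne_top_of_le_ne_top hb.tsum_ofReal_ne_top (ENNReal.tsum_le_tsum hXint)
  filter_upwards [ae_lt_top' (AEMeasurable.tsum hmeas) hfin] with ω hω
  have h := ENNReal.tendsto_atTop_zero_of_tsum_ne_top hω.ne
  have h' := (ENNReal.tendsto_toReal ENNReal.zero_ne_top).comp h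
  refine h'.congr fun k => ?_
  simp [ENNReal.toReal_ofReal (hZ0 k ω)]

lemma tendsto_choose_div_pow (m : ℕ) :
    Tendsto (fun n : ℕ => (n.choose m : ℝ) / (n : ℝ) ^ m) atTop (𝓝 (m.factorial : ℝ)⁻¹) := by
  have hne : ∀ᶠ n : ℕ in atTop, ((n : ℝ) ^ m / m.factorial) ≠ 0 := by
    filter_upwards [eventually_gt_atTop 0] with n hn
    positivity
  have h := (Asymptotics.isEquivalent_iff_tendsto_one hne).1 (isEquivalent_choose m)
  have h' := h.mul_const (m.factorial : ℝ)⁻¹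
  rw [one_mul] at h'
  refine h'.congr fun n => ?_
  have : (m.factorial : ℝ) ≠ 0 := by positivity
  simp only [Pi.div_apply]
  field_simp

/-- A sequence of ratios greater than `1` tending to `1`. -/
noncomputable def geomRatio (j : ℕ) : ℝ := 1 + 1 / ((j : ℝ) + 1)

lemma one_lt_geomRatio (j : ℕ) : 1 < geomRatio j := by
  have : (0 : ℝ) < 1 / ((j : ℝ) + 1) := by positivity
  unfold geomRatio; linarith

lemma tendsto_div_pow_of_monotone {S : ℕ → ℝ} (hS0 : ∀ n, 0 ≤ S n) (hS : Monotone S) {m : ℕ}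
    (hm : m ≠ 0) {l : ℝ} (hl : 0 ≤ l)
    (h : ∀ j, Tendsto (fun k : ℕ => S ⌊(geomRatio j ^ 8) ^ k⌋₊ /
      (⌊(geomRatio j ^ 8) ^ k⌋₊ : ℝ) ^ m) atTop (𝓝 l)) :
    Tendsto (fun n : ℕ => S n / (n : ℝ) ^ m) atTop (𝓝 l) := by
  have hm0 : (0 : ℝ) ≤ (m : ℝ)⁻¹ := by positivity
  have hdiv : ∀ n : ℕ, S n ^ (m : ℝ)⁻¹ / n = (S n / (n : ℝ) ^ m) ^ (m : ℝ)⁻¹ := fun n => by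
    rw [Real.div_rpow (hS0 n) (by positivity), Real.pow_rpow_inv_natCast (by positivity) hm]
  have hlim : Tendsto (fun j => geomRatio j ^ 8) atTop (𝓝 1) := by
    have h1 : Tendsto geomRatio atTop (𝓝 1) := by
      have := (tendsto_one_div_add_atTop_nhds_zero_nat (𝕜 := ℝ)).const_add 1
      rwa [add_zero] at this
    simpa using h1.pow 8
  have key := tendsto_div_of_monotone_of_tendsto_div_floor_pow (fun n => S n ^ (m : ℝ)⁻¹)
    (l ^ (m : ℝ)⁻¹) (fun a b hab => Real.rpow_le_rpow (hS0 a) (hS hab) hm0)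
    (fun j => geomRatio j ^ 8) (fun j => one_lt_pow₀ (one_lt_geomRatio j) (by norm_num)) hlim
    (fun j => by
      simp only [hdiv]
      exact (h j).rpow_const (Or.inr hm0))
  have key' := key.pow m
  rw [Real.rpow_inv_natCast_pow hl hm] at key'
  refine key'.congr fun n => ?_
  rw [hdiv, Real.rpow_inv_natCast_pow (div_nonneg (hS0 n) (by positivity)) hm]

lemma sub_min_le_of_mul_posLog_le {x T δ w : ℝ} (hx : 0 ≤ x) (hT : 1 < T) (hδ : 0 < δ)
    (hw : 0 ≤ w) (h : x * Real.posLog x ^ (1 + δ) ≤ w) :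
    x - min x T ≤ w / Real.log T ^ (1 + δ) := by
  have hlog : 0 < Real.log T := Real.log_pos hT
  have hlp : 0 < Real.log T ^ (1 + δ) := Real.rpow_pos_of_pos hlog _
  rcases le_total x T with hxT | hTx
  · rw [min_eq_left hxT, sub_self]; positivity
  · rw [min_eq_right hTx, le_div_iff₀ hlp]
    have h1 : Real.log T ≤ Real.posLog x :=
      (Real.log_le_log (by linarith) hTx).trans (le_max_right _ _)
    calc (x - T) * Real.log T ^ (1 + δ) ≤ x * Real.posLog x ^ (1 + δ) := by
          gcongr
          linarith
      _ ≤ w := h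

end Limits

section Nonneg

variable {Y : Type*} [MeasurableSpace Y]
  {P : Kernel Y Y} [IsMarkovKernel P] {π : Measure Y} {V : Y → ℝ} {ρ : ℕ → ℝ}

lemma sum_V_nonneg (hA : ErgodicityAssumption P π V ρ) {m : ℕ} (y : Fin m → Y) :
    0 ≤ ∑ i, V (y i) :=
  Finset.sum_nonneg fun i _ => zero_le_one.trans (hA.one_le_V (y i))

lemma integrable_sum_V_chainLaw (hA : ErgodicityAssumption P π V ρ) {μ : Measure Y}
    [IsProbabilityMeasure μ] (hμ : supMoment P μ V < ∞) {m : ℕ} (i : Fin m → ℕ) :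
    Integrable (fun ω : ℕ → Y => ∑ j, V (ω (i j))) (chainLaw P μ) :=
  integrable_finsetSum _ fun j _ => integrable_V_chainLaw hA hμ (i j)

lemma integral_sum_V_chainLaw_le (hA : ErgodicityAssumption P π V ρ) {μ : Measure Y}
    [IsProbabilityMeasure μ] (hμ : supMoment P μ V < ∞) {m : ℕ} (i : Fin m → ℕ) :
    ∫ ω, ∑ j, V (ω (i j)) ∂(chainLaw P μ) ≤ m * (supMoment P μ V).toReal := by
  rw [integral_finsetSum _ fun j _ => integrable_V_chainLaw hA hμ (i j)]
  refine (Finset.sum_le_card_nsmul _ _ _ fun j _ => integral_V_chainLaw_le hA hμ (i j)).trans_eq ?_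
  simp

lemma integrable_of_mul_posLog_le {Ω : Type*} [MeasurableSpace Ω] {ν : Measure Ω}
    [IsProbabilityMeasure ν] {X W : Ω → ℝ} (hX : AEStronglyMeasurable X ν) (hX0 : ∀ ω, 0 ≤ X ω)
    (hW : Integrable W ν) (hW0 : ∀ ω, 0 ≤ W ω) {δ : ℝ} (hδ : 0 < δ)
    (h : ∀ ω, X ω * Real.posLog (X ω) ^ (1 + δ) ≤ W ω) : Integrable X ν := by
  refine ((integrable_const (Real.exp 1)).add hW).mono' hX (.of_forall fun ω => ?_)
  have h1 := sub_min_le_of_mul_posLog_le (hX0 ω) (Real.one_lt_exp_iff.2 one_pos) hδ (hW0 ω) (h ω)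
  rw [Real.log_exp, Real.one_rpow, div_one] at h1
  rw [Real.norm_of_nonneg (hX0 ω)]
  have h2 : min (X ω) (Real.exp 1) ≤ Real.exp 1 := min_le_right _ _
  simp only [Pi.add_apply]
  linarith

lemma measurable_comp_coord {m : ℕ} {h : (Fin m → Y) → ℝ} (hmeas : Measurable h)
    (i : Fin m → ℕ) : Measurable fun ω : ℕ → Y => h fun j => ω (i j) :=
  hmeas.comp (measurable_pi_lambda _ fun _ => measurable_pi_apply _)

variable {m : ℕ} {h : (Fin m → Y) → ℝ} {K δ : ℝ}

lemma integrable_chainLaw_of_mul_posLog_le (hA : ErgodicityAssumption P π V ρ) {μ : Measure Y}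
    [IsProbabilityMeasure μ] (hμ : supMoment P μ V < ∞) (hmeas : Measurable h)
    (h0 : ∀ y, 0 ≤ h y) (hδ : 0 < δ) (hK : 0 ≤ K)
    (hbound : ∀ y, h y * Real.posLog (h y) ^ (1 + δ) ≤ K * ∑ i, V (y i)) (i : Fin m → ℕ) :
    Integrable (fun ω : ℕ → Y => h fun j => ω (i j)) (chainLaw P μ) :=
  integrable_of_mul_posLog_le (measurable_comp_coord hmeas i).aestronglyMeasurable
    (fun _ => h0 _) ((integrable_sum_V_chainLaw hA hμ i).const_mul K)
    (fun ω => mul_nonneg hK (sum_V_nonneg hA fun j => ω (i j))) hδ fun _ => hbound _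

lemma integrable_pi_of_mul_posLog_le (hA : ErgodicityAssumption P π V ρ) (hmeas : Measurable h)
    (h0 : ∀ y, 0 ≤ h y) (hδ : 0 < δ) (hK : 0 ≤ K)
    (hbound : ∀ y, h y * Real.posLog (h y) ^ (1 + δ) ≤ K * ∑ i, V (y i)) :
    Integrable h (Measure.pi fun _ : Fin m => π) := by
  have hπ := hA.isProbabilityMeasure
  have hV : Integrable (fun y : Fin m → Y => ∑ i, V (y i)) (Measure.pi fun _ : Fin m => π) :=
    integrable_finsetSum _ fun i _ =>
      (measurePreserving_eval (fun _ : Fin m => π) i).integrable_comp_of_integrable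
        hA.integrable_V
  exact integrable_of_mul_posLog_le hmeas.aestronglyMeasurable h0 (hV.const_mul K)
    (fun y => mul_nonneg hK (sum_V_nonneg hA y)) hδ hbound

lemma card_tuples_le_pow (m n : ℕ) : ((tuples m n).card : ℝ) ≤ (n : ℝ) ^ m := by
  have : (tuples m n).card ≤ n ^ m := by
    refine (Finset.card_filter_le _ _).trans ?_
    simp
  exact_mod_cast this

/-- Truncating the kernel at height `T` changes the normalised `U`-statistic by at most a multiple
of `(log T) ^ (-(1 + δ))` in mean. -/
lemma integral_sum_sub_min_le (hA : ErgodicityAssumption P π V ρ) {μ : Measure Y}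
    [IsProbabilityMeasure μ] (hμ : supMoment P μ V < ∞) (hmeas : Measurable h)
    (h0 : ∀ y, 0 ≤ h y) (hδ : 0 < δ) (hK : 0 ≤ K)
    (hbound : ∀ y, h y * Real.posLog (h y) ^ (1 + δ) ≤ K * ∑ i, V (y i))
    {T : ℝ} (hT : 1 < T) (n : ℕ) :
    Integrable (fun ω : ℕ → Y => (∑ i ∈ tuples m n,
        (h (fun j => ω (i j)) - min (h fun j => ω (i j)) T)) / (n : ℝ) ^ m) (chainLaw P μ) ∧
    ∫ ω, (∑ i ∈ tuples m n,
        (h (fun j => ω (i j)) - min (h fun j => ω (i j)) T)) / (n : ℝ) ^ m ∂(chainLaw P μ) ≤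
      K * (m * (supMoment P μ V).toReal) / Real.log T ^ (1 + δ) := by
  have hlp : 0 < Real.log T ^ (1 + δ) := Real.rpow_pos_of_pos (Real.log_pos hT) _
  have hXint : ∀ i : Fin m → ℕ, Integrable (fun ω : ℕ → Y =>
      h (fun j => ω (i j)) - min (h fun j => ω (i j)) T) (chainLaw P μ) := fun i => by
    have hi := integrable_chainLaw_of_mul_posLog_le hA hμ hmeas h0 hδ hK hbound i
    exact hi.sub (hi.inf (integrable_const T))
  refine ⟨(integrable_finsetSum _ fun i _ => hXint i).div_const _, ?_⟩
  rw [integral_div, integral_finsetSum _ fun i _ => hXint i]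
  have hone : ∀ i : Fin m → ℕ, ∫ ω, (h (fun j => ω (i j)) - min (h fun j => ω (i j)) T)
      ∂(chainLaw P μ) ≤ K * (m * (supMoment P μ V).toReal) / Real.log T ^ (1 + δ) := fun i => by
    calc _ ≤ ∫ ω, K / Real.log T ^ (1 + δ) * ∑ j, V (ω (i j)) ∂(chainLaw P μ) := by
          refine integral_mono (hXint i)
            ((integrable_sum_V_chainLaw hA hμ i).const_mul _) fun ω => ?_
          have := sub_min_le_of_mul_posLog_le (h0 fun j => ω (i j)) hT hδ
            (mul_nonneg hK (sum_V_nonneg hA fun j => ω (i j))) (hbound fun j => ω (i j))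
          exact this.trans_eq (by ring)
      _ ≤ K / Real.log T ^ (1 + δ) * (m * (supMoment P μ V).toReal) := by
          rw [integral_const_mul]
          gcongr
          exact integral_sum_V_chainLaw_le hA hμ i
      _ = _ := by ring
  refine div_le_of_le_mul₀ (by positivity) (by positivity) ?_
  refine (Finset.sum_le_card_nsmul _ _ _ fun i _ => hone i).trans ?_
  rw [nsmul_eq_mul, mul_comm]
  have := card_tuples_le_pow m n
  gcongr

lemma tendsto_integral_min {α : Type*} [MeasurableSpace α] {ν : Measure α} {f : α → ℝ}
    (hf : Integrable f ν) (hf0 : ∀ x, 0 ≤ f x) {T : ℕ → ℝ} (hT0 : ∀ k, 0 ≤ T k)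
    (hT : Tendsto T atTop atTop) :
    Tendsto (fun k => ∫ x, min (f x) (T k) ∂ν) atTop (𝓝 (∫ x, f x ∂ν)) := by
  refine tendsto_integral_of_dominated_convergence f
    (fun k => hf.aestronglyMeasurable.inf aestronglyMeasurable_const) hf
    (fun k => .of_forall fun x => ?_) (.of_forall fun x => ?_)
  · rw [Real.norm_of_nonneg (le_min (hf0 x) (hT0 k))]; exact min_le_left _ _
  · refine tendsto_const_nhds.congr' ?_
    filter_upwards [hT.eventually_ge_atTop (f x)] with k hk
    rw [min_eq_left hk]

/-- Along `⌊(β ^ 8) ^ k⌋`, the `U`-statistic of a nonnegative kernel converges almost surely and in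
mean; the kernel is truncated at height `β ^ (k + 1)`. -/
lemma tendsto_along_geometric (hA : ErgodicityAssumption P π V ρ) {r : ℝ} (hr : 1 < r)
    (hρ : ρ =O[atTop] fun n : ℕ => (n : ℝ) ^ (-r)) {μ : Measure Y}
    [IsProbabilityMeasure μ] (hμ : supMoment P μ V < ∞) (hmeas : Measurable h)
    (h0 : ∀ y, 0 ≤ h y) (hδ : 0 < δ) (hK : 0 ≤ K)
    (hbound : ∀ y, h y * Real.posLog (h y) ^ (1 + δ) ≤ K * ∑ i, V (y i))
    {β : ℝ} (hβ : 1 < β) :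
    (∀ᵐ ω ∂(chainLaw P μ), Tendsto (fun k : ℕ =>
      (∑ i ∈ tuples m ⌊(β ^ 8) ^ k⌋₊, h fun j => ω (i j)) / (⌊(β ^ 8) ^ k⌋₊ : ℝ) ^ m) atTop
      (𝓝 ((m.factorial : ℝ)⁻¹ * ∫ y, h y ∂(Measure.pi fun _ : Fin m => π)))) ∧
    Tendsto (fun k : ℕ =>
      (∑ i ∈ tuples m ⌊(β ^ 8) ^ k⌋₊, ∫ ω, h (fun j => ω (i j)) ∂(chainLaw P μ)) /
        (⌊(β ^ 8) ^ k⌋₊ : ℝ) ^ m) atTop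
      (𝓝 ((m.factorial : ℝ)⁻¹ * ∫ y, h y ∂(Measure.pi fun _ : Fin m => π))) := by
  have hπ := hA.isProbabilityMeasure
  have hβ0 : 0 < β := one_pos.trans hβ
  have hβ8 : 1 < β ^ 8 := one_lt_pow₀ hβ (by norm_num)
  set N : ℕ → ℕ := fun k => ⌊(β ^ 8) ^ k⌋₊ with hN
  let T : ℕ → ℝ := fun k => β ^ (k + 1)
  have hT1 : ∀ k, 1 < T k := fun k => one_lt_pow₀ hβ (by omega)
  have hT0 : ∀ k, 0 < T k := fun k => one_pos.trans (hT1 k)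
  have hTtop : Tendsto T atTop atTop :=
    (tendsto_pow_atTop_atTop_of_one_lt hβ).comp (tendsto_add_atTop_nat 1)
  have hN1 : ∀ k, 1 ≤ N k := fun k => Nat.floor_pos.2 (one_le_pow₀ hβ8.le)
  have hNtop : Tendsto N atTop atTop :=
    tendsto_nat_floor_atTop.comp (tendsto_pow_atTop_atTop_of_one_lt hβ8)
  let c : ℕ → ℝ := fun k => ∫ y, min (h y) (T k) ∂(Measure.pi fun _ : Fin m => π)
  have hclim : Tendsto c atTop (𝓝 (∫ y, h y ∂(Measure.pi fun _ : Fin m => π))) :=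
    tendsto_integral_min (integrable_pi_of_mul_posLog_le hA hmeas h0 hδ hK hbound) h0
      (fun k => (hT0 k).le) hTtop
  let X : ℕ → (ℕ → Y) → ℝ := fun k ω =>
    (∑ i ∈ tuples m (N k), (min (h fun j => ω (i j)) (T k) - c k)) / (N k : ℝ) ^ m
  let R : ℕ → (ℕ → Y) → ℝ := fun k ω =>
    (∑ i ∈ tuples m (N k), (h (fun j => ω (i j)) - min (h fun j => ω (i j)) (T k))) /
      (N k : ℝ) ^ m
  have hdec : ∀ k ω, (∑ i ∈ tuples m (N k), h fun j => ω (i j)) / (N k : ℝ) ^ m =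
      X k ω + R k ω + ((N k).choose m : ℝ) / (N k : ℝ) ^ m * c k := fun k ω => by
    simp only [X, R, Finset.sum_sub_distrib, Finset.sum_const, card_tuples, nsmul_eq_mul]
    ring
  have hdet : Tendsto (fun k => ((N k).choose m : ℝ) / (N k : ℝ) ^ m * c k) atTop
      (𝓝 ((m.factorial : ℝ)⁻¹ * ∫ y, h y ∂(Measure.pi fun _ : Fin m => π))) :=
    ((tendsto_choose_div_pow m).comp hNtop).mul hclim
  have hR0 : ∀ k ω, 0 ≤ R k ω := fun k ω =>
    div_nonneg (Finset.sum_nonneg fun i _ => sub_nonneg.2 (min_le_left _ _)) (by positivity)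
  have hRint : ∀ k, Integrable (R k) (chainLaw P μ) := fun k =>
    (integral_sum_sub_min_le hA hμ hmeas h0 hδ hK hbound (hT1 k) (N k)).1
  let bR : ℕ → ℝ := fun k =>
    K * (m * (supMoment P μ V).toReal) / Real.log (T k) ^ (1 + δ)
  have hRb : ∀ k, ∫ ω, R k ω ∂(chainLaw P μ) ≤ bR k := fun k =>
    (integral_sum_sub_min_le hA hμ hmeas h0 hδ hK hbound (hT1 k) (N k)).2
  have hbR : Summable bR := by
    have h1 : Summable fun k : ℕ => 1 / ((k + 1 : ℕ) : ℝ) ^ (1 + δ) :=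
      (summable_nat_add_iff 1).2 (Real.summable_one_div_nat_rpow.2 (by linarith))
    refine (h1.mul_left (K * (m * (supMoment P μ V).toReal) / Real.log β ^ (1 + δ))).congr
      fun k => ?_
    simp only [bR, T]
    rw [Real.log_pow, Real.mul_rpow (by positivity) (Real.log_pos hβ).le]
    field_simp
  obtain ⟨C, hC0, hC⟩ := exists_integral_sq_le hA hr hρ hμ m
  have hminT : ∀ k (y : Fin m → Y), |min (h y) (T k)| ≤ T k := fun k y => by
    rw [abs_of_nonneg (le_min (h0 y) (hT0 k).le)]; exact min_le_right _ _
  have hcT : ∀ k, |c k| ≤ T k := fun k => abs_integral_le_of_abs_le (hminT k)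
  have hXm : ∀ k, Measurable (X k) := fun k =>
    (Finset.measurable_sum _ fun i _ =>
      ((measurable_comp_coord hmeas i).min measurable_const).sub_const _).div_const _
  have hXbd : ∀ k, ∃ B, ∀ ω, |X k ω| ≤ B := fun k => by
    refine ⟨((tuples m (N k)).card • (2 * T k)) / (N k : ℝ) ^ m, fun ω => ?_⟩
    simp only [X]
    rw [abs_div, abs_of_nonneg (by positivity : (0 : ℝ) ≤ (N k : ℝ) ^ m)]
    gcongr
    refine (Finset.abs_sum_le_sum_abs _ _).trans (Finset.sum_le_card_nsmul _ _ _ fun i _ => ?_)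
    refine (abs_sub _ _).trans ?_
    have h1 := hminT k fun j => ω (i j)
    have h2 := hcT k
    linarith
  have hXL : ∀ k, MemLp (X k) 2 (chainLaw P μ) := fun k => by
    obtain ⟨B, hB⟩ := hXbd k
    exact MemLp.of_bound (hXm k).aestronglyMeasurable B (.of_forall hB)
  set q := 1 - (β ^ 8)⁻¹ with hq
  have hq0 : 0 < q := sub_pos.2 (inv_lt_one_of_one_lt₀ hβ8)
  let bX : ℕ → ℝ := fun k => C * β ^ 2 / √q * ((β ^ 2)⁻¹) ^ k
  have hbX : Summable bX := (summable_geometric_of_lt_one (by positivity)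
    (inv_lt_one_of_one_lt₀ (one_lt_pow₀ hβ (by norm_num)))).mul_left _
  have hXb : ∀ k, ∫ ω, X k ω ^ 2 ∂(chainLaw P μ) ≤ bX k := fun k => by
    have hNk : (0 : ℝ) < N k := by exact_mod_cast hN1 k
    have h1 := hC (N k) (hN1 k) (T k) (hT0 k) (fun y => min (h y) (T k))
      (hmeas.min measurable_const) (hminT k)
    have h2 : √q * (β ^ 4) ^ k ≤ √(N k : ℝ) := by
      refine Real.le_sqrt_of_sq_le ?_
      rw [mul_pow, Real.sq_sqrt hq0.le]
      refine le_trans (le_of_eq ?_) (mul_pow_le_nat_floor_pow hβ8 k)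
      rw [hq]; ring
    have hpos : 0 < √q * (β ^ 4) ^ k := mul_pos (Real.sqrt_pos.2 hq0) (by positivity)
    simp only [X, div_pow]
    rw [integral_div, div_le_iff₀ (by positivity)]
    refine h1.trans ?_
    calc C * T k ^ 2 * ((N k : ℝ) ^ m) ^ 2 / √(N k : ℝ)
        ≤ C * T k ^ 2 * ((N k : ℝ) ^ m) ^ 2 / (√q * (β ^ 4) ^ k) := by gcongr
      _ = bX k * ((N k : ℝ) ^ m) ^ 2 := by
          simp only [bX, T]
          have : √q ≠ 0 := (Real.sqrt_pos.2 hq0).ne'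
          rw [inv_pow]
          field_simp
          ring
  constructor
  · filter_upwards [ae_tendsto_zero_of_summable_integral hRint hR0 hbR hRb,
      ae_tendsto_zero_of_summable_integral (fun k => (hXL k).integrable_sq)
        (fun k ω => sq_nonneg (X k ω)) hbX hXb] with ω hω1 hω2
    have hω3 : Tendsto (fun k => X k ω) atTop (𝓝 0) := by
      have := hω2.sqrt
      simp only [Real.sqrt_sq_eq_abs, Real.sqrt_zero] at this
      exact (tendsto_zero_iff_abs_tendsto_zero _).2 this
    refine Tendsto.congr (fun k => (hdec k ω).symm) ?_
    simpa using (hω3.add hω1).add hdet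
  · have hERlim : Tendsto (fun k => ∫ ω, R k ω ∂(chainLaw P μ)) atTop (𝓝 0) :=
      squeeze_zero (fun k => integral_nonneg (hR0 k)) hRb hbR.tendsto_atTop_zero
    have hEXlim : Tendsto (fun k => ∫ ω, X k ω ∂(chainLaw P μ)) atTop (𝓝 0) := by
      have h1 : Tendsto (fun k => (∫ ω, X k ω ∂(chainLaw P μ)) ^ 2) atTop (𝓝 0) := by
        refine squeeze_zero (fun k => sq_nonneg _) (fun k => ?_) hbX.tendsto_atTop_zero
        have hv := variance_nonneg (X k) (chainLaw P μ)
        rw [variance_eq_sub (hXL k)] at hv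
        have := hXb k
        simp only [Pi.pow_apply] at hv
        linarith
      have := h1.sqrt
      simp only [Real.sqrt_sq_eq_abs, Real.sqrt_zero] at this
      exact (tendsto_zero_iff_abs_tendsto_zero _).2 this
    have hE : ∀ k, (∑ i ∈ tuples m (N k), ∫ ω, h (fun j => ω (i j)) ∂(chainLaw P μ)) /
        (N k : ℝ) ^ m = ∫ ω, X k ω ∂(chainLaw P μ) + ∫ ω, R k ω ∂(chainLaw P μ) +
          ((N k).choose m : ℝ) / (N k : ℝ) ^ m * c k := fun k => by
      have hXi := (hXL k).integrable one_le_two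
      rw [← integral_finsetSum _ fun i _ =>
        integrable_chainLaw_of_mul_posLog_le hA hμ hmeas h0 hδ hK hbound i, ← integral_div]
      simp only [hdec]
      have hXR : Integrable (fun ω => X k ω + R k ω) (chainLaw P μ) := hXi.add (hRint k)
      rw [integral_add hXR (integrable_const _), integral_add hXi (hRint k)]
      simp
    refine Tendsto.congr (fun k => (hE k).symm) ?_
    simpa using (hEXlim.add hERlim).add hdet

lemma tendsto_of_tendsto_div_pow {S : ℕ → ℝ} {m : ℕ} {l : ℝ}
    (h : Tendsto (fun n : ℕ => S n / (n : ℝ) ^ m) atTop (𝓝 ((m.factorial : ℝ)⁻¹ * l))) :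
    Tendsto (fun n : ℕ => ((n.choose m : ℕ) : ℝ)⁻¹ * S n) atTop (𝓝 l) := by
  have hf : (m.factorial : ℝ)⁻¹ ≠ 0 := by positivity
  have h1 := h.div (tendsto_choose_div_pow m) hf
  rw [mul_div_cancel_left₀ _ hf] at h1
  refine h1.congr' ?_
  filter_upwards [eventually_gt_atTop 0] with n hn
  have : (n : ℝ) ^ m ≠ 0 := by positivity
  rw [Pi.div_apply, div_div_div_cancel_right₀ this, div_eq_inv_mul]

lemma tendsto_of_nonneg (hA : ErgodicityAssumption P π V ρ) {r : ℝ} (hr : 1 < r)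
    (hρ : ρ =O[atTop] fun n : ℕ => (n : ℝ) ^ (-r)) {μ : Measure Y}
    [IsProbabilityMeasure μ] (hμ : supMoment P μ V < ∞) (hm : 1 ≤ m) (hmeas : Measurable h)
    (h0 : ∀ y, 0 ≤ h y) (hδ : 0 < δ) (hK : 0 ≤ K)
    (hbound : ∀ y, h y * Real.posLog (h y) ^ (1 + δ) ≤ K * ∑ i, V (y i)) :
    (∀ᵐ ω ∂(chainLaw P μ), Tendsto (fun n : ℕ =>
      ((n.choose m : ℕ) : ℝ)⁻¹ * ∑ i ∈ tuples m n, h fun j => ω (i j)) atTop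
      (𝓝 (∫ y, h y ∂(Measure.pi fun _ : Fin m => π)))) ∧
    Tendsto (fun n : ℕ => ((n.choose m : ℕ) : ℝ)⁻¹ *
      ∑ i ∈ tuples m n, ∫ ω, h (fun j => ω (i j)) ∂(chainLaw P μ)) atTop
      (𝓝 (∫ y, h y ∂(Measure.pi fun _ : Fin m => π))) := by
  have hl : 0 ≤ (m.factorial : ℝ)⁻¹ * ∫ y, h y ∂(Measure.pi fun _ : Fin m => π) :=
    mul_nonneg (by positivity) (integral_nonneg h0)
  have hg := fun j => tendsto_along_geometric hA hr hρ hμ hmeas h0 hδ hK hbound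
    (one_lt_geomRatio j)
  constructor
  · filter_upwards [ae_all_iff.2 fun j => (hg j).1] with ω hω
    refine tendsto_of_tendsto_div_pow (tendsto_div_pow_of_monotone
      (fun n => Finset.sum_nonneg fun i _ => h0 _) (fun a b hab => ?_) (by omega) hl hω)
    exact Finset.sum_le_sum_of_subset_of_nonneg (tuples_mono m hab) fun _ _ _ => h0 _
  · refine tendsto_of_tendsto_div_pow (tendsto_div_pow_of_monotone
      (fun n => Finset.sum_nonneg fun i _ => integral_nonneg fun _ => h0 _)
      (fun a b hab => ?_) (by omega) hl fun j => (hg j).2)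
    exact Finset.sum_le_sum_of_subset_of_nonneg (tuples_mono m hab)
      fun _ _ _ => integral_nonneg fun _ => h0 _

end Nonneg

end UStatMarkov

theorem theorem2 {Y : Type*} [MeasurableSpace Y]
    (P : Kernel Y Y) [IsMarkovKernel P] (π : Measure Y) (V : Y → ℝ) (ρ : ℕ → ℝ)
    (hA : ErgodicityAssumption P π V ρ)
    (r : ℝ) (hr : 1 < r) (hρ : ρ =O[atTop] fun n : ℕ => (n : ℝ) ^ (-r))
    (m : ℕ) (hm : 1 ≤ m) (h : (Fin m → Y) → ℝ) (hmeas : Measurable h) (hsymm : IsSymmetric h)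
    (δ : ℝ) (hδ : 0 < δ)
    (hbound : BddAbove (Set.range fun y : Fin m → Y =>
      |h y| * (Real.posLog |h y|) ^ (1 + δ) / ∑ i, V (y i)))
    (μ : Measure Y) [IsProbabilityMeasure μ] (hμ : supMoment P μ V < ∞) :
    (∀ n, ∀ i ∈ tuples m n, Integrable (fun ω : ℕ → Y => h fun j => ω (i j)) (chainLaw P μ)) ∧
    (∀ᵐ ω ∂(chainLaw P μ), Tendsto (fun n : ℕ => ((n.choose m : ℕ) : ℝ)⁻¹ *
        ∑ i ∈ tuples m n,
          (h (fun j => ω (i j)) - ∫ ω', h (fun j => ω' (i j)) ∂(chainLaw P μ)))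
      atTop (𝓝 0)) ∧
    Integrable h (Measure.pi fun _ : Fin m => π) ∧
    Tendsto (fun n : ℕ => ((n.choose m : ℕ) : ℝ)⁻¹ *
        ∑ i ∈ tuples m n, ∫ ω, h (fun j => ω (i j)) ∂(chainLaw P μ))
      atTop (𝓝 (∫ y, h y ∂(Measure.pi fun _ : Fin m => π))) := by
  obtain ⟨K₀, hK₀⟩ := hbound
  set K := max K₀ 0 with hKdef
  have hK : 0 ≤ K := le_max_right _ _
  have hW : ∀ y : Fin m → Y, 0 < ∑ i, V (y i) := fun y =>
    Finset.sum_pos (fun i _ => zero_lt_one.trans_le (hA.one_le_V (y i)))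
      ⟨⟨0, hm⟩, Finset.mem_univ _⟩
  have hbd : ∀ y, |h y| * Real.posLog |h y| ^ (1 + δ) ≤ K * ∑ i, V (y i) := fun y =>
    (div_le_iff₀ (hW y)).1 ((hK₀ ⟨y, rfl⟩).trans (le_max_left _ _))
  have hbd' : ∀ f : (Fin m → Y) → ℝ, (∀ y, 0 ≤ f y) → (∀ y, f y ≤ |h y|) →
      ∀ y, f y * Real.posLog (f y) ^ (1 + δ) ≤ K * ∑ i, V (y i) := fun f hf0 hf y => by
    refine le_trans ?_ (hbd y)
    have := Real.posLog_le_posLog (hf0 y) (hf y)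
    have := Real.posLog_nonneg (x := f y)
    have := hf0 y
    have := hf y
    gcongr
  let hp : (Fin m → Y) → ℝ := fun y => max (h y) 0
  let hn : (Fin m → Y) → ℝ := fun y => max (-h y) 0
  have hpn : ∀ y, h y = hp y - hn y := fun y => (max_zero_sub_max_neg_zero_eq_self (h y)).symm
  have hp0 : ∀ y, 0 ≤ hp y := fun y => le_max_right _ _
  have hn0 : ∀ y, 0 ≤ hn y := fun y => le_max_right _ _
  have hpm : Measurable hp := hmeas.max measurable_const
  have hnm : Measurable hn := hmeas.neg.max measurable_const
  have hpb := hbd' hp hp0 fun y => max_le (le_abs_self _) (abs_nonneg _)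
  have hnb := hbd' hn hn0 fun y => max_le (neg_le_abs _) (abs_nonneg _)
  have hpi := integrable_chainLaw_of_mul_posLog_le hA hμ hpm hp0 hδ hK hpb
  have hni := integrable_chainLaw_of_mul_posLog_le hA hμ hnm hn0 hδ hK hnb
  have hpπ := integrable_pi_of_mul_posLog_le hA hpm hp0 hδ hK hpb
  have hnπ := integrable_pi_of_mul_posLog_le hA hnm hn0 hδ hK hnb
  obtain ⟨hp1, hp2⟩ := tendsto_of_nonneg hA hr hρ hμ hm hpm hp0 hδ hK hpb
  obtain ⟨hn1, hn2⟩ := tendsto_of_nonneg hA hr hρ hμ hm hnm hn0 hδ hK hnb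
  have hE : ∀ i : Fin m → ℕ, ∫ ω, h (fun j => ω (i j)) ∂(chainLaw P μ) =
      ∫ ω, hp (fun j => ω (i j)) ∂(chainLaw P μ) - ∫ ω, hn (fun j => ω (i j)) ∂(chainLaw P μ) :=
    fun i => by
      simp only [hpn]
      exact integral_sub (hpi i) (hni i)
  have hEπ : ∫ y, h y ∂(Measure.pi fun _ : Fin m => π) =
      ∫ y, hp y ∂(Measure.pi fun _ : Fin m => π) - ∫ y, hn y ∂(Measure.pi fun _ : Fin m => π) := by
    simp only [hpn]
    exact integral_sub hpπ hnπ
  have hmean : Tendsto (fun n : ℕ => ((n.choose m : ℕ) : ℝ)⁻¹ *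
      ∑ i ∈ tuples m n, ∫ ω, h (fun j => ω (i j)) ∂(chainLaw P μ))
      atTop (𝓝 (∫ y, h y ∂(Measure.pi fun _ : Fin m => π))) := by
    rw [hEπ]
    refine (hp2.sub hn2).congr fun n => ?_
    simp only [hE, Finset.sum_sub_distrib, mul_sub]
  refine ⟨fun n i _ => ?_, ?_, ?_, hmean⟩
  · exact ((hpi i).sub (hni i)).congr (.of_forall fun ω => (hpn fun j => ω (i j)).symm)
  · filter_upwards [hp1, hn1] with ω hω1 hω2
    have hlim := (hω1.sub hω2).sub hmean
    rw [hEπ, sub_self] at hlim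
    refine hlim.congr fun n => ?_
    rw [← mul_sub, ← mul_sub, ← Finset.sum_sub_distrib, ← Finset.sum_sub_distrib]
    simp only [← hpn]
  · exact (hpπ.sub hnπ).congr (.of_forall fun y => (hpn y).symm)
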